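/- Let $Q \subset M$ be a finite-index subfactor of a $\mathrm{II}_1$ factor $M$, with Jones index $[M:Q]=\dim_Q L^2(M)$. For a planar tangle $T$ (an external disc of colour $k_0$, internal discs $D_1,\dots,D_b$ of colours $k_1,\dots,k_b$, $b \ge 0$, where a disc of colour $k\in\{0_+,0_-,1,2,\dots\}$ has $2k$ marked points on its boundary (none for $0_\pm$), together with disjoint strings and a checkerboard shading), let $l(T)$ be the number of closed loops obtained after capping the black boundary intervals of the external disc of $T$ (joining the two end points of each such interval) and cupping the black boundary intervals of all internal discs of $T$, and put \[ c(T)=\bigl(\lceil k_0/2\rceil+\lfloor k_1/2\rfloor+\dots+\lfloor k_b/2\rfloor\bigr)-l(T),\qquad \alpha(T)=[M:Q]^{\frac12 c(T)}. \] Let $T=T^{k_0}_{k_1,\dots,k_b}$ and $\tilde T=\tilde T^{\tilde k_0}_{\tilde k_1,\dots,\tilde k_{\tilde b}}$ be planar tangles with discs of the indicated colours such that $\tilde k_0=k_i$ for some $1\le i\le b$, and let $T\circ_i\tilde T$ be the tangle obtained by inserting $\tilde T$ into the $i$-th internal disc of $T$. Then \[ \frac{\alpha(T)\,\alpha(\tilde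 T)}{\alpha(T\circ_i\tilde T)}=[M:Q]^{\frac12\left(\tilde k_0-l(T)-l(\tilde T)+l(T\circ_i\tilde T)\right)}. \] (In arithmetic expressions the colours $0_\pm$ count as $0$.) -/

import Mathlib

open scoped ENNReal InnerProductSpace

noncomputable section

namespace IntermediatePlanar

universe u

/-! ## II₁ factors and the Jones index -/

section Index

variable {H : Type u} [NormedAddCommGroup H] [InnerProductSpace ℂ H] [CompleteSpace H]

/-- `τ` restricts to a faithful normal tracial state on the von Neumann algebra `A`
(its values outside `A` play no role). Normality is expressed by writing `τ` as a sum of vector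
functionals `x ↦ ⟨ξₙ, x ξₙ⟩` with `∑ ‖ξₙ‖² < ∞`; this includes linearity and positivity on `A`. -/
structure IsFaithfulNormalTrace (A : VonNeumannAlgebra H) (τ : (H →L[ℂ] H) → ℂ) : Prop where
  map_one : τ 1 = 1
  normal : ∃ ξ : ℕ → H, (Summable fun n => ‖ξ n‖ ^ 2) ∧
    ∀ x ∈ A, HasSum (fun n => ⟪ξ n, x (ξ n)⟫_ℂ) (τ x)
  tracial : ∀ x ∈ A, ∀ y ∈ A, τ (x * y) = τ (y * x)
  faithful : ∀ x ∈ A, τ (star x * x) = 0 → x = 0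

/-- The algebra carries a faithful normal tracial state. For a factor this means that it is
finite, and the tracial state is then unique. -/
def HasTrace (A : VonNeumannAlgebra H) : Prop :=
  ∃ τ : (H →L[ℂ] H) → ℂ, IsFaithfulNormalTrace A τ

open Classical in
/-- The normalized trace `tr_A` of a finite factor `A` (and `0` if there is no trace). -/
def normalizedTrace (A : VonNeumannAlgebra H) : (H →L[ℂ] H) → ℂ :=
  if h : HasTrace A then h.choose else 0

/-- `A` is a factor: its centre consists of the scalars. -/
def IsFactor (A : VonNeumannAlgebra H) : Prop :=
  ∀ x ∈ A, x ∈ A.commutant → ∃ c : ℂ, x = c • (1 : H →L[ℂ] H)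

/-- `A` is a factor of type II₁: an infinite-dimensional factor with a faithful normal
tracial state. -/
structure IsTypeIIOneFactor (A : VonNeumannAlgebra H) : Prop where
  factor : IsFactor A
  infinite : ¬ FiniteDimensional ℂ A.toStarSubalgebra
  hasTrace : HasTrace A

/-- The closed subspace `closure (A ξ)`. -/
def cyclicSubspace (A : VonNeumannAlgebra H) (ξ : H) : Submodule ℂ H :=
  (Submodule.span ℂ {η : H | ∃ x ∈ A, η = x ξ}).topologicalClosure

/-- The orthogonal projection of `H` onto `closure (A ξ)`; it lies in the commutant of `A`. -/
def cyclicProjection (A : VonNeumannAlgebra H) (ξ : H) : H →L[ℂ] H :=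
  haveI : CompleteSpace (cyclicSubspace A ξ) :=
    (Submodule.isClosed_topologicalClosure _).completeSpace_coe
  (cyclicSubspace A ξ).starProjection

open Classical in
/-- The Murray-von Neumann coupling constant `dim_A H` of a II₁ factor `A` acting on `H`,
computed at a nonzero vector `ξ` (on which it does not depend):
`tr_A [A' ξ] / tr_{A'} [A ξ]` if the commutant `A'` is finite, and `∞` otherwise. -/
def couplingConstant (A : VonNeumannAlgebra H) (ξ : H) : ℝ≥0∞ :=
  if HasTrace A.commutant then
    ENNReal.ofReal ((normalizedTrace A (cyclicProjection A.commutant ξ)).re /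
      (normalizedTrace A.commutant (cyclicProjection A ξ)).re)
  else ⊤

/-- `Ω` is a cyclic unit vector for `M` whose vector state is a trace on `M`. This says exactly
that `(H, Ω)` is, up to unitary equivalence, the GNS space `L²(M)` of the trace of `M` together
with its canonical vector. -/
structure IsTraceVector (M : VonNeumannAlgebra H) (Ω : H) : Prop where
  norm_eq_one : ‖Ω‖ = 1
  cyclic : cyclicSubspace M Ω = ⊤
  tracial : ∀ x ∈ M, ∀ y ∈ M, ⟪Ω, (x * y) Ω⟫_ℂ = ⟪Ω, (y * x) Ω⟫_ℂ

/-- The Jones index `[M : Q] = dim_Q L²(M)` of a subfactor `Q` of a II₁ factor `M`, where `M` acts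
on `H = L²(M)` with canonical trace vector `Ω`. -/
def jonesIndex (Q : VonNeumannAlgebra H) (Ω : H) : ℝ≥0∞ :=
  couplingConstant Q Ω

end Index

/-! ## Planar tangles -/

/-- The colours `0₊, 0₋, 1, 2, 3, …`. -/
inductive Colour where
  | zeroPlus : Colour
  | zeroMinus : Colour
  | pos : ℕ+ → Colour

/-- The number `k` belonging to a colour; a disc of this colour has `2 k` marked points. -/
def Colour.size : Colour → ℕ
  | .zeroPlus => 0
  | .zeroMinus => 0
  | .pos k => k

/-- `f` is ambient isotopic to the identity of the plane (equivalently, it preserves the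
orientation). -/
def IsIsotopicToId (f : ℂ ≃ₜ ℂ) : Prop :=
  ∃ F : unitInterval × ℂ → ℂ, Continuous F ∧
    (∀ t, ∃ h : ℂ ≃ₜ ℂ, ∀ z, F (t, z) = h z) ∧
    (∀ z, F (0, z) = z) ∧ (∀ z, F (1, z) = f z)

/-- The point of the unit circle reached from `1` after `θ` clockwise turns. -/
def clockwise (θ : ℝ) : ℂ := Complex.exp (-(2 * Real.pi * θ : ℝ) * Complex.I)

/-- The `m`-th of the `2 k` standard marked points on the unit circle (`m = 0, …, 2 k - 1`),
numbered clockwise, with the point `1` on the arc between the last and the first of them. -/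
def standardPoint (k m : ℕ) : ℂ := clockwise ((2 * m + 1) / (4 * k))

/-- The union of the `k` black intervals of the unit circle with its `2 k` standard marked points:
the closed arcs running clockwise from the point `2 i` to the point `2 i + 1`, `i < k`. -/
def standardBlackIntervals (k : ℕ) : Set ℂ :=
  {u | ∃ i < k, ∃ θ ∈ Set.Icc ((4 * i + 1 : ℝ) / (4 * k)) ((4 * i + 3) / (4 * k)),
    u = clockwise θ}

/-- A closed disc in the plane with a colour `k` and `2 k` marked points on its boundary which are
numbered clockwise, starting from a distinguished boundary arc `*`. It is given by a homeomorphism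
of the plane that maps the standard disc, with the point `1` on its `*`-arc, to it. -/
structure MarkedDisc where
  colour : Colour
  param : ℂ ≃ₜ ℂ
  isotopic : IsIsotopicToId param

namespace MarkedDisc

/-- The number `k` of the disc. -/
def size (D : MarkedDisc) : ℕ := D.colour.size

/-- The closed disc. -/
def carrier (D : MarkedDisc) : Set ℂ := D.param '' Metric.closedBall 0 1

/-- The open disc. -/
def inside (D : MarkedDisc) : Set ℂ := D.param '' Metric.ball 0 1

/-- The `m`-th marked point, `m < 2 k`. -/
def point (D : MarkedDisc) (m : ℕ) : ℂ := D.param (standardPoint D.size m)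

/-- The set of marked points. -/
def points (D : MarkedDisc) : Set ℂ := {z | ∃ m < 2 * D.size, z = D.point m}

/-- The union of the black intervals of the boundary (empty if there are no marked points). -/
def blackIntervals (D : MarkedDisc) : Set ℂ := D.param '' standardBlackIntervals D.size

/-- `f` carries `D` to `E`, respecting colours and the numbered marked points. -/
structure MapsTo (f : ℂ ≃ₜ ℂ) (D E : MarkedDisc) : Prop where
  colour_eq : E.colour = D.colour
  carrier_eq : E.carrier = f '' D.carrier
  point_eq : ∀ m < 2 * D.size, E.point m = f (D.point m)

end MarkedDisc

/-- `s` is a single string: either an embedded arc with both ends at marked points (the set `P`)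
and otherwise in the open set `U`, or an embedded circle in `U`. -/
def IsString (P U s : Set ℂ) : Prop :=
  (∃ γ : C(unitInterval, ℂ), Function.Injective γ ∧ Set.range γ = s ∧ γ 0 ∈ P ∧ γ 1 ∈ P ∧
      ∀ t, t ≠ 0 → t ≠ 1 → γ t ∈ U) ∨
    (∃ γ : C(Circle, ℂ), Function.Injective γ ∧ Set.range γ = s ∧ s ⊆ U)

/-- A planar tangle: an external marked disc, `b` internal marked discs, a finite system of
disjoint strings between marked points or closed (`strings` is their union) and a checkerboard
shading (`black` is the union of the black regions). On every boundary with marked points the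
arcs are alternately white and black, the `*`-arc being white; the boundary of a disc of
colour `0₊` is white and that of a disc of colour `0₋` is black. -/
structure Tangle where
  outer : MarkedDisc
  b : ℕ
  inner : Fin b → MarkedDisc
  strings : Set ℂ
  black : Set ℂ
  inner_subset : ∀ j, (inner j).carrier ⊆ outer.inside
  inner_disjoint : ∀ i j, i ≠ j → Disjoint (inner i).carrier (inner j).carrier
  strings_spec : ∃ (n : ℕ) (s : Fin n → Set ℂ),
    (∀ i j, i ≠ j → Disjoint (s i) (s j)) ∧ strings = ⋃ i, s i ∧
    ∀ i, IsString (outer.points ∪ ⋃ j, (inner j).points)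
      (outer.inside \ ⋃ j, (inner j).carrier) (s i)
  points_subset : outer.points ∪ ⋃ j, (inner j).points ⊆ strings
  black_subset : black ⊆ outer.carrier \ ((⋃ j, (inner j).inside) ∪ strings)
  /-- `black` is a union of connected regions of the complement of the strings. -/
  black_clopen : IsClopen
    (Subtype.val ⁻¹' black : Set ↥(outer.carrier \ ((⋃ j, (inner j).inside) ∪ strings)))
  /-- The two sides of each string have different colours. -/
  checkerboard : ∀ z ∈ strings, z ∈ closure black ∧
    z ∈ closure ((outer.carrier \ ((⋃ j, (inner j).inside) ∪ strings)) \ black)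
  boundary_shading : ∀ D : MarkedDisc, (D = outer ∨ ∃ j, D = inner j) →
    ∀ v ∈ Metric.sphere (0 : ℂ) 1, D.param v ∉ D.points →
      (D.param v ∈ black ↔ v ∈ standardBlackIntervals D.size ∨ D.colour = Colour.zeroMinus)

namespace Tangle

/-- The curves obtained from the strings of `T` by capping the black intervals of the external
disc and cupping the black intervals of all internal discs. The cap or cup that joins the two ends
of a black interval is drawn along this interval. -/
def capped (T : Tangle) : Set ℂ :=
  T.strings ∪ T.outer.blackIntervals ∪ ⋃ j, (T.inner j).blackIntervals

/-- `l(T)`: the number of closed loops after black capping and cupping. The capped curves are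
disjoint closed loops, so this is the number of connected components of their union. -/
def loops (T : Tangle) : ℕ := Nat.card (ConnectedComponents ↥T.capped)

/-- `c(T) = (⌈k₀/2⌉ + ⌊k₁/2⌋ + ⋯ + ⌊k_b/2⌋) - l(T)`. -/
def c (T : Tangle) : ℤ :=
  (⌈(T.outer.size : ℚ) / 2⌉ + ∑ j, ⌊((T.inner j).size : ℚ) / 2⌋) - T.loops

/-- `α(T) = [M : Q] ^ (c(T) / 2)`, where `M` acts on `L²(M)` with trace vector `Ω`. -/
def alpha {H : Type u} [NormedAddCommGroup H] [InnerProductSpace ℂ H] [CompleteSpace H]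
    (Q : VonNeumannAlgebra H) (Ω : H) (T : Tangle) : ℝ :=
  (jonesIndex Q Ω).toReal ^ ((1 / 2 : ℝ) * T.c)

/-- `S` represents the composite `T ∘ᵢ T'`: after isotopies `f` of `T` and `g` of `T'`, the external
disc of `T'` coincides with the `i`-th internal disc of `T`, with the same numbered marked points,
and `S` is obtained by inserting `T'` into this disc and erasing its boundary. The internal discs
of `S` are those of `T` other than the `i`-th one together with those of `T'`. -/
def IsComposition (T : Tangle) (i : Fin T.b) (T' S : Tangle) : Prop :=
  ∃ (f g : ℂ ≃ₜ ℂ) (e : {j : Fin T.b // j ≠ i} ⊕ Fin T'.b ≃ Fin S.b),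
    IsIsotopicToId f ∧ IsIsotopicToId g ∧
    f '' (T.inner i).carrier = g '' T'.outer.carrier ∧
    (∀ m < 2 * (T.inner i).size, f ((T.inner i).point m) = g (T'.outer.point m)) ∧
    MarkedDisc.MapsTo f T.outer S.outer ∧
    (∀ j, MarkedDisc.MapsTo f (T.inner j.1) (S.inner (e (Sum.inl j)))) ∧
    (∀ j, MarkedDisc.MapsTo g (T'.inner j) (S.inner (e (Sum.inr j)))) ∧
    S.strings = f '' T.strings ∪ g '' T'.strings ∧
    S.black = f '' T.black ∪ g '' T'.black

end Tangle

end IntermediatePlanar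

end

namespace IntermediatePlanar

section Index

universe u

variable {H : Type u} [NormedAddCommGroup H] [InnerProductSpace ℂ H] [CompleteSpace H]

/-! All three values of `alpha` are powers of one base, so the claim is additivity of exponents. In
`T.c + T'.c - S.c` every disc that survives in the composite cancels. The glued disc remains: it
contributes a floor as an inner disc of `T` and a ceiling as the outer disc of `T'`, and these sum
to its colour (`ceil_half_add_floor_half`). The loop numbers are simply carried along.

The laws of real exponents need a positive base. The index is a ratio of traces of nonzero cyclic
projections, which are positive by faithfulness (`couplingConstant_pos`). -/

theorem apply_mem_cyclicSubspace (A : VonNeumannAlgebra H) (ξ : H) {a : H →L[ℂ] H} (ha : a ∈ A)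
    {η : H} (hη : η ∈ cyclicSubspace A ξ) : a η ∈ cyclicSubspace A ξ := by
  have hspan : ∀ ζ ∈ Submodule.span ℂ {η : H | ∃ x ∈ A, η = x ξ},
      a ζ ∈ Submodule.span ℂ {η : H | ∃ x ∈ A, η = x ξ} := by
    intro ζ hζ
    induction hζ using Submodule.span_induction with
    | mem y hy =>
      obtain ⟨x, hx, rfl⟩ := hy
      exact Submodule.subset_span ⟨a * x, mul_mem ha hx, rfl⟩
    | zero => simp
    | add y z _ _ hy hz => rw [map_add]; exact add_mem hy hz
    | smul c y _ hy => rw [map_smul]; exact Submodule.smul_mem _ c hy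
  exact map_mem_closure a.continuous hη hspan

theorem mem_cyclicSubspace_self (A : VonNeumannAlgebra H) (ξ : H) : ξ ∈ cyclicSubspace A ξ :=
  Submodule.le_topologicalClosure _ (Submodule.subset_span ⟨1, one_mem A, rfl⟩)

theorem isStarProjection_cyclicProjection (A : VonNeumannAlgebra H) (ξ : H) :
    IsStarProjection (cyclicProjection A ξ) := by
  have : CompleteSpace (cyclicSubspace A ξ) :=
    (Submodule.isClosed_topologicalClosure _).completeSpace_coe
  exact isStarProjection_starProjection

theorem cyclicProjection_ne_zero (A : VonNeumannAlgebra H) {ξ : H} (hξ : ξ ≠ 0) :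
    cyclicProjection A ξ ≠ 0 := by
  have : CompleteSpace (cyclicSubspace A ξ) :=
    (Submodule.isClosed_topologicalClosure _).completeSpace_coe
  intro h
  have hfix : cyclicProjection A ξ ξ = ξ :=
    Submodule.starProjection_eq_self_iff.2 (mem_cyclicSubspace_self A ξ)
  rw [h] at hfix
  exact hξ hfix.symm

/-- Since `A` is closed under adjoints, it leaves both the cyclic subspace and its orthogonal
complement invariant, so the projection commutes with `A`. -/
theorem cyclicProjection_mem_commutant (A : VonNeumannAlgebra H) (ξ : H) :
    cyclicProjection A ξ ∈ A.commutant := by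
  have : CompleteSpace (cyclicSubspace A ξ) :=
    (Submodule.isClosed_topologicalClosure _).completeSpace_coe
  rw [VonNeumannAlgebra.mem_commutant_iff]
  intro a ha
  ext x
  change a ((cyclicSubspace A ξ).starProjection x) = (cyclicSubspace A ξ).starProjection (a x)
  refine (Submodule.eq_starProjection_of_mem_orthogonal
    (apply_mem_cyclicSubspace A ξ ha (Submodule.starProjection_apply_mem _ x)) ?_).symm
  rw [← map_sub, Submodule.mem_orthogonal]
  intro η hη
  rw [← ContinuousLinearMap.adjoint_inner_left]
  exact (Submodule.mem_orthogonal _ _).1 (Submodule.sub_starProjection_mem_orthogonal x) _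
    (apply_mem_cyclicSubspace A ξ (star_mem ha) hη)

/-- A faithful normal trace is strictly positive on nonzero projections. -/
theorem IsFaithfulNormalTrace.re_pos {A : VonNeumannAlgebra H} {τ : (H →L[ℂ] H) → ℂ}
    (hτ : IsFaithfulNormalTrace A τ) {p : H →L[ℂ] H} (hp : p ∈ A) (hproj : IsStarProjection p)
    (hne : p ≠ 0) : 0 < (τ p).re := by
  have hpp : star p * p = p := by
    rw [hproj.isSelfAdjoint.star_eq]; exact hproj.isIdempotentElem
  -- Each vector functional of the trace is real and nonnegative at `p`, and hence so is their sum.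
  have hinner : ∀ ζ : H, ⟪ζ, p ζ⟫_ℂ = ((‖p ζ‖ ^ 2 : ℝ) : ℂ) := by
    intro ζ
    calc ⟪ζ, p ζ⟫_ℂ = ⟪ζ, (star p * p) ζ⟫_ℂ := by rw [hpp]
      _ = ⟪p ζ, p ζ⟫_ℂ := ContinuousLinearMap.adjoint_inner_right p ζ (p ζ)
      _ = ((‖p ζ‖ ^ 2 : ℝ) : ℂ) := by rw [inner_self_eq_norm_sq_to_K]; norm_cast
  obtain ⟨ξ, -, hsum⟩ := hτ.normal
  have hs := hsum p hp
  simp only [hinner] at hs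
  have hre : 0 ≤ (τ p).re := (Complex.hasSum_re hs).nonneg fun n => by
    rw [Complex.ofReal_re]; positivity
  have him : (τ p).im = 0 := by
    have h := Complex.hasSum_im hs
    simp only [Complex.ofReal_im] at h
    exact h.unique hasSum_zero
  refine lt_of_le_of_ne hre fun h => hne (hτ.faithful p hp ?_)
  rw [hpp]
  exact Complex.ext h.symm him

theorem HasTrace.isFaithfulNormalTrace_normalizedTrace {A : VonNeumannAlgebra H}
    (h : HasTrace A) : IsFaithfulNormalTrace A (normalizedTrace A) := by
  rw [normalizedTrace, dif_pos h]
  exact h.choose_spec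

theorem couplingConstant_pos {A : VonNeumannAlgebra H} (hA : HasTrace A) {ξ : H} (hξ : ξ ≠ 0) :
    0 < couplingConstant A ξ := by
  unfold couplingConstant
  split_ifs with h
  · refine ENNReal.ofReal_pos.2 (div_pos ?_ ?_)
    · refine hA.isFaithfulNormalTrace_normalizedTrace.re_pos ?_
        (isStarProjection_cyclicProjection _ _) (cyclicProjection_ne_zero _ hξ)
      -- By the double commutant identity, the projection onto the closure of `A' ξ` lies in `A`.
      simpa only [VonNeumannAlgebra.commutant_commutant] using
        cyclicProjection_mem_commutant A.commutant ξ
    · exact h.isFaithfulNormalTrace_normalizedTrace.re_pos (cyclicProjection_mem_commutant A ξ)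
        (isStarProjection_cyclicProjection _ _) (cyclicProjection_ne_zero _ hξ)
  · exact ENNReal.zero_lt_top

end Index

theorem ceil_half_add_floor_half (k : ℕ) : ⌈(k : ℚ) / 2⌉ + ⌊(k : ℚ) / 2⌋ = (k : ℤ) := by
  have hfloor : ⌊(k : ℚ) / 2⌋ = (k : ℤ) / 2 := by
    simpa only [Int.cast_natCast, Nat.cast_ofNat] using Rat.floor_intCast_div_natCast (k : ℤ) 2
  -- Both roundings become integer floor divisions, so that `omega` settles the two parities.
  have hceil : ⌈(k : ℚ) / 2⌉ = -(-(k : ℤ) / 2) := by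
    simpa only [Int.cast_natCast, Nat.cast_ofNat] using Rat.ceil_intCast_div_natCast (k : ℤ) 2
  rw [hfloor, hceil]
  omega

theorem MarkedDisc.MapsTo.size_eq {f : ℂ ≃ₜ ℂ} {D E : MarkedDisc} (h : MapsTo f D E) :
    E.size = D.size :=
  congrArg Colour.size h.colour_eq

/-- The discs of a composite are those of the two tangles other than the disc along which
they are glued. -/
theorem Tangle.IsComposition.c_add_c_sub_c {T T' S : Tangle} {i : Fin T.b}
    (hcolour : T'.outer.colour = (T.inner i).colour) (hS : T.IsComposition i T' S) :
    T.c + T'.c - S.c = T'.outer.size - T.loops - T'.loops + S.loops := by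
  obtain ⟨f, g, e, -, -, -, -, houter, hinl, hinr, -, -⟩ := hS
  have hsize : (T.inner i).size = T'.outer.size := (congrArg Colour.size hcolour).symm
  have hsumS : ∑ j, ⌊((S.inner j).size : ℚ) / 2⌋ =
      ∑ j : {j : Fin T.b // j ≠ i}, ⌊((T.inner j.1).size : ℚ) / 2⌋ +
        ∑ j, ⌊((T'.inner j).size : ℚ) / 2⌋ := by
    rw [← e.sum_comp, Fintype.sum_sum_type]
    simp only [(hinl _).size_eq, (hinr _).size_eq]
  have hsumT : ∑ j, ⌊((T.inner j).size : ℚ) / 2⌋ = ⌊(T'.outer.size : ℚ) / 2⌋ +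
      ∑ j : {j : Fin T.b // j ≠ i}, ⌊((T.inner j.1).size : ℚ) / 2⌋ := by
    -- The `i`-th term is split off, with its size rewritten as that of the outer disc of `T'`, to
    -- meet the ceiling in `T'.c`.
    rw [Fintype.sum_eq_add_sum_subtype_ne _ i, hsize]
  have hhalf := ceil_half_add_floor_half T'.outer.size
  unfold Tangle.c
  rw [hsumS, hsumT, houter.size_eq]
  linarith

end IntermediatePlanar

theorem proposition3p1 {H : Type*} [NormedAddCommGroup H] [InnerProductSpace ℂ H]
    [CompleteSpace H] (M Q : VonNeumannAlgebra H) (Ω : H)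
    (hM : IntermediatePlanar.IsTypeIIOneFactor M)
    (hΩ : IntermediatePlanar.IsTraceVector M Ω)
    (hQ : IntermediatePlanar.IsTypeIIOneFactor Q) (hQM : Q ≤ M)
    (hfin : IntermediatePlanar.jonesIndex Q Ω ≠ ⊤)
    (T T' S : IntermediatePlanar.Tangle) (i : Fin T.b)
    (hcolour : T'.outer.colour = (T.inner i).colour)
    (hS : T.IsComposition i T' S) :
    T.alpha Q Ω * T'.alpha Q Ω / S.alpha Q Ω =
      (IntermediatePlanar.jonesIndex Q Ω).toReal ^
        ((1 / 2 : ℝ) * ((T'.outer.size : ℝ) - T.loops - T'.loops + S.loops)) := by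
  have hΩ0 : Ω ≠ 0 := norm_ne_zero_iff.1 (by rw [hΩ.norm_eq_one]; exact one_ne_zero)
  -- Finiteness matters here: `toReal` sends `⊤` to `0`.
  have hpos : 0 < (IntermediatePlanar.jonesIndex Q Ω).toReal :=
    ENNReal.toReal_pos (IntermediatePlanar.couplingConstant_pos hQ.hasTrace hΩ0).ne' hfin
  have hc : (T.c : ℝ) + T'.c - S.c = T'.outer.size - T.loops - T'.loops + S.loops := by
    exact_mod_cast hS.c_add_c_sub_c hcolour
  unfold IntermediatePlanar.Tangle.alpha
  rw [← Real.rpow_add hpos, ← Real.rpow_sub hpos, ← hc]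
  congr 1
  ring
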